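/- Let $G$ be a finite simple graph with $n\ge 1$ vertices, $m\ge \frac n2$ edges and maximum degree $\Delta_1$. Assume that $G$ is not isomorphic to $K_{1,\,n-r-1}\cup rK_1$ (the disjoint union of a star on $n-r$ vertices and $r$ isolated vertices) for any integer $r$ with $0\le r\le \lceil \frac n2\rceil-2$ or $r=n-2\ge 0$. Let $\mu_1\ge\mu_2\ge\cdots\ge\mu_n=0$ be the eigenvalues of the Laplacian matrix $L(G)=D(G)-A(G)$, where $D(G)$ is the diagonal matrix of vertex degrees and $A(G)$ is the adjacency matrix, and let $$LE(G)=\sum_{i=1}^n\left|\mu_i-\frac{2m}{n}\right|$$ be the Laplacian energy of $G$. Then $$LE(G)\le 4m-2\Delta_1-\frac{8m}{n}+4,$$ and this bound is at least as good as the bound $4m-2\Delta_1-\frac{4m}{n}+2$, that is, $$4m-2\Delta_1-\frac{8m}{n}+4\le 4m-2\Delta_1-\frac{4m}{n}+2.$$ -/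

import Mathlib

open scoped SimpleGraph

noncomputable section

/-- The Laplacian eigenvalues `μ₁ ≥ μ₂ ≥ ⋯ ≥ μₙ` of a finite simple graph, listed with multiplicity
in decreasing order: the eigenvalues of the real symmetric matrix `L(G) = D(G) - A(G)`. -/
def laplacianEigenvalue {V : Type*} [Fintype V] [DecidableEq V] (G : SimpleGraph V)
    [DecidableRel G.Adj] : Fin (Fintype.card V) → ℝ :=
  (G.isHermitian_lapMatrix ℝ).eigenvalues₀

/-- The Laplacian energy `LE(G) = ∑ |μᵢ - 2m/n|` of a graph with `n` vertices and `m` edges. -/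
def laplacianEnergy {V : Type*} [Fintype V] [DecidableEq V] (G : SimpleGraph V)
    [DecidableRel G.Adj] : ℝ :=
  ∑ i, |laplacianEigenvalue G i - 2 * (G.edgeFinset.card : ℝ) / (Fintype.card V : ℝ)|

/-- The graph `K_{1,k} ∪ r K₁`: the disjoint union of a star with `k` edges and `r` isolated
vertices. -/
def starUnionIsolated (k r : ℕ) : SimpleGraph ((Fin 1 ⊕ Fin k) ⊕ Fin r) :=
  completeBipartiteGraph (Fin 1) (Fin k) ⊕g (⊥ : SimpleGraph (Fin r))

/-- `G`, of order `n`, is isomorphic to `K_{1,n-r-1} ∪ r K₁` for some integer `r` with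
`0 ≤ r ≤ ⌈n/2⌉ - 2` or `r = n - 2`. The bounds on `r` are compared in `ℤ`. -/
def IsExceptionalStar {V : Type*} [Fintype V] (G : SimpleGraph V) : Prop :=
  ∃ k r : ℕ, k + r + 1 = Fintype.card V ∧
    ((r : ℤ) ≤ ⌈(Fintype.card V : ℚ) / 2⌉ - 2 ∨ (r : ℤ) = (Fintype.card V : ℤ) - 2) ∧
    Nonempty (G ≃g starUnionIsolated k r)

end

/-! Put c = 2m/n and let S index the eigenvalues at least c. Deviations from the mean c cancel, so
LE is twice the sum of μ - c over S. Split the trace of the Laplacian on the span of the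
S-eigenvectors by edges: an edge off v contributes at most 2, and the star at v at most |S| + d(v),
so the trace is at most 2m - d(v) + |S| (`sum_lapMatrix_form_le`). For v of maximum degree, LE ≤ 4m
- 2Δ₁ - 2|S|(c - 1), which suffices if |S| ≥ 2, as c ≥ 1. If |S| = 1, μ ≤ m + 1
(`lapMatrix_eigenvalues_le`) reduces the claim to c ≤ m - Δ₁ + 1, which the excluded stars could
violate. -/

open Finset in
/-- Bessel's inequality in coordinates. -/
theorem sum_sq_coord_le {V ι : Type*} [Fintype V]
    {b : ι → EuclideanSpace ℝ V} (hb : Orthonormal ℝ b) (S : Finset ι) (z : V → ℝ) :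
    ∑ k ∈ S, (∑ x, z x * b k x) ^ 2 ≤ ∑ x, z x ^ 2 := by
  have h := hb.sum_inner_products_le (WithLp.toLp 2 z) (s := S)
  simpa [EuclideanSpace.norm_sq_eq, PiLp.inner_apply] using h

open Finset in
-- Bessel for `e_i - e_j`, whose squared norm is 2.
theorem sum_sq_sub_coord_le_two {V ι : Type*} [Fintype V] [DecidableEq V]
    {b : ι → EuclideanSpace ℝ V} (hb : Orthonormal ℝ b) (S : Finset ι) {i j : V} (hij : i ≠ j) :
    ∑ k ∈ S, (b k i - b k j) ^ 2 ≤ 2 := by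
  have h := sum_sq_coord_le hb S (Pi.single i 1 - Pi.single j 1)
  have h1 : ∑ x, (Pi.single i 1 - Pi.single j 1 : V → ℝ) x ^ 2 = 2 := by
    have : ∀ x, (Pi.single i 1 - Pi.single j 1 : V → ℝ) x ^ 2
        = (Pi.single i 1 : V → ℝ) x + (Pi.single j 1 : V → ℝ) x := by
      intro x
      by_cases hi : x = i
      · subst hi; simp [hij]
      · by_cases hj : x = j
        · subst hj; simp [hij.symm]
        · simp [hi, hj]
    simp only [this, sum_add_distrib, sum_pi_single']
    norm_num
  rw [h1] at h
  simpa [sub_mul, sum_sub_distrib, Pi.single_apply] using h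

open Finset in
/-- The Laplacian quadratic form of a star is at most the identity plus a rank-one form. -/
theorem star_form_le {V : Type*} [Fintype V] [DecidableEq V] {v : V} {N : Finset V}
    (hv : v ∉ N) (u : V → ℝ) :
    ∑ y ∈ N, (u v - u y) ^ 2 ≤ ∑ x, u x ^ 2 + (#N * u v - ∑ y ∈ N, u y) ^ 2 / (#N + 1) := by
  have h1 : u v ^ 2 + ∑ y ∈ N, u y ^ 2 ≤ ∑ x, u x ^ 2 := by
    rw [← sum_insert (f := fun x => u x ^ 2) hv]
    exact sum_le_sum_of_subset_of_nonneg (subset_univ _) fun _ _ _ => sq_nonneg _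
  have h2 : ∑ y ∈ N, (u v - u y) ^ 2
      = #N * u v ^ 2 - 2 * u v * ∑ y ∈ N, u y + ∑ y ∈ N, u y ^ 2 := by
    simp only [sub_sq, sum_add_distrib, sum_sub_distrib, sum_const, nsmul_eq_mul, mul_sum]
  -- After clearing the denominator, the gap is exactly `(u v + ∑ y ∈ N, u y) ^ 2`.
  have h3 : (#N - 1) * u v ^ 2 - 2 * u v * ∑ y ∈ N, u y
      ≤ (#N * u v - ∑ y ∈ N, u y) ^ 2 / (#N + 1) := by
    rw [le_div_iff₀ (by positivity)]
    nlinarith [sq_nonneg (u v + ∑ y ∈ N, u y)]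
  linarith

open Finset in
-- Sum `star_form_le` over the unit vectors `b k`; Bessel controls the rank-one part, whose vector
-- `#N • e_v - ∑ e_y` has squared norm `#N * (#N + 1)`.
theorem sum_star_form_le {V ι : Type*} [Fintype V] [DecidableEq V]
    {b : ι → EuclideanSpace ℝ V} (hb : Orthonormal ℝ b) (S : Finset ι) {v : V} {N : Finset V}
    (hv : v ∉ N) :
    ∑ k ∈ S, ∑ y ∈ N, (b k v - b k y) ^ 2 ≤ #S + #N := by
  have hz : ∀ u : V → ℝ, ∑ x, ((Pi.single v (#N : ℝ) : V → ℝ) x - if x ∈ N then 1 else 0) * u x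
      = #N * u v - ∑ y ∈ N, u y := by
    intro u
    simp [sub_mul, sum_sub_distrib, Pi.single_apply]
  have hz2 : ∑ x, ((Pi.single v (#N : ℝ) : V → ℝ) x - if x ∈ N then 1 else 0) ^ 2
      = (#N : ℝ) * (#N + 1) := by
    have : ∀ x, ((Pi.single v (#N : ℝ) : V → ℝ) x - if x ∈ N then 1 else 0) ^ 2
        = (Pi.single v ((#N : ℝ) ^ 2) : V → ℝ) x + if x ∈ N then (1 : ℝ) else 0 := by
      intro x
      by_cases hx : x = v
      · subst hx; simp [hv]
      · by_cases hN : x ∈ N <;> simp [hx, hN]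
    simp only [this, sum_add_distrib, sum_pi_single']
    simp
    ring
  have h := sum_sq_coord_le hb S fun x => (Pi.single v (#N : ℝ) : V → ℝ) x - if x ∈ N then 1 else 0
  rw [hz2] at h
  simp only [hz] at h
  have hone : ∀ k, ∑ x, b k x ^ 2 = 1 := by
    intro k
    have := EuclideanSpace.norm_sq_eq (b k)
    rw [hb.1 k] at this
    simpa using this.symm
  calc ∑ k ∈ S, ∑ y ∈ N, (b k v - b k y) ^ 2
      ≤ ∑ k ∈ S, (1 + (#N * b k v - ∑ y ∈ N, b k y) ^ 2 / (#N + 1)) :=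
        sum_le_sum fun k _ => by simpa only [hone] using star_form_le hv (b k)
    _ = #S + (∑ k ∈ S, (#N * b k v - ∑ y ∈ N, b k y) ^ 2) / (#N + 1) := by
        rw [sum_add_distrib, sum_div]; simp
    _ ≤ #S + #N := by
        gcongr
        rw [div_le_iff₀ (by positivity)]
        exact h

/-! ### Laplacian traces and eigenvalues -/

namespace SimpleGraph

variable {V : Type*} [Fintype V] [DecidableEq V] (G : SimpleGraph V) [DecidableRel G.Adj]

open Finset in
omit [DecidableEq V] in
theorem sum_sum_ite_adj : ∑ i : V, ∑ j : V, (if G.Adj i j then (2 : ℝ) else 0)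
    = 4 * #G.edgeFinset := by
  have h : ∀ i, ∑ j : V, (if G.Adj i j then (2 : ℝ) else 0) = 2 * G.degree i := by
    intro i
    rw [degree_eq_sum_if_adj, mul_sum]
    simp
  simp only [h, ← mul_sum]
  rw [← Nat.cast_sum, sum_degrees_eq_twice_card_edges]
  push_cast
  ring

open Finset in
/-- Splitting a symmetric sum over ordered pairs of vertices at a vertex. -/
theorem sum_sum_eq_add_sum_erase {f : V → V → ℝ} (hf : ∀ i j, f i j = f j i) (v : V)
    (hv : f v v = 0) :
    ∑ i, ∑ j, f i j = 2 * ∑ j, f v j + ∑ i ∈ univ.erase v, ∑ j ∈ univ.erase v, f i j := by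
  have h : ∀ i, ∑ j, f i j = f i v + ∑ j ∈ univ.erase v, f i j := fun i =>
    (add_sum_erase _ _ (mem_univ v)).symm
  have h2 : ∑ i ∈ univ.erase v, f i v = ∑ j, f v j := by
    rw [h v, hv, zero_add]
    exact sum_congr rfl fun i _ => hf i v
  rw [← add_sum_erase _ _ (mem_univ v)]
  rw [sum_congr rfl fun i _ => h i, sum_add_distrib, h2]
  ring

open Finset in
/-- The trace of the Laplacian on a subspace of dimension `k` is at most `2m - d(v) + k`. -/
theorem sum_lapMatrix_form_le {ι : Type*} {b : ι → EuclideanSpace ℝ V} (hb : Orthonormal ℝ b)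
    (S : Finset ι) (v : V) :
    ∑ k ∈ S, (∑ i : V, ∑ j : V, if G.Adj i j then (b k i - b k j) ^ 2 else 0) / 2
      ≤ 2 * #G.edgeFinset - G.degree v + #S := by
  have hswap : ∑ k ∈ S, (∑ i : V, ∑ j : V, if G.Adj i j then (b k i - b k j) ^ 2 else 0) / 2
      = (∑ i : V, ∑ j : V, if G.Adj i j then ∑ k ∈ S, (b k i - b k j) ^ 2 else 0) / 2 := by
    rw [← sum_div, sum_comm]
    congr 1
    refine sum_congr rfl fun i _ => ?_
    rw [sum_comm]
    refine sum_congr rfl fun j _ => ?_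
    split_ifs <;> simp
  have h2 := G.sum_sum_ite_adj
  rw [sum_sum_eq_add_sum_erase (fun i j => by simp [G.adj_comm]) v (by simp)] at h2
  have hd : ∑ j : V, (if G.Adj v j then (2 : ℝ) else 0) = 2 * G.degree v := by
    rw [degree_eq_sum_if_adj, mul_sum]
    simp
  have hs : ∑ j : V, (if G.Adj v j then ∑ k ∈ S, (b k v - b k j) ^ 2 else 0)
      ≤ #S + G.degree v := by
    have := sum_star_form_le hb S (G.notMem_neighborFinset_self v)
    rw [sum_comm, card_neighborFinset_eq_degree] at this
    rwa [← sum_filter, ← neighborFinset_eq_filter]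
  have hr : ∑ i ∈ univ.erase v, ∑ j ∈ univ.erase v,
        (if G.Adj i j then ∑ k ∈ S, (b k i - b k j) ^ 2 else 0)
      ≤ ∑ i ∈ univ.erase v, ∑ j ∈ univ.erase v, (if G.Adj i j then (2 : ℝ) else 0) := by
    refine sum_le_sum fun i _ => sum_le_sum fun j _ => ?_
    split_ifs with h
    · exact sum_sq_sub_coord_le_two hb S h.ne
    · exact le_rfl
  rw [hswap, sum_sum_eq_add_sum_erase (fun i j => ?_) v (by simp)]
  · linarith
  · simp only [G.adj_comm i j, sub_sq_comm]

theorem lapMatrix_eigenvalues_eq (k : V) :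
    (G.isHermitian_lapMatrix ℝ).eigenvalues k
      = (∑ i : V, ∑ j : V, if G.Adj i j then
          ((G.isHermitian_lapMatrix ℝ).eigenvectorBasis k i
            - (G.isHermitian_lapMatrix ℝ).eigenvectorBasis k j) ^ 2 else 0) / 2 := by
  rw [← lapMatrix_toLinearMap₂' ℝ G, Matrix.toLinearMap₂'_apply',
    (G.isHermitian_lapMatrix ℝ).eigenvalues_eq]
  simp

theorem degree_add_degree_le_card_edgeFinset_add_one {x y : V} (h : G.Adj x y) :
    G.degree x + G.degree y ≤ G.edgeFinset.card + 1 := by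
  rw [← card_incidenceFinset_eq_degree, ← card_incidenceFinset_eq_degree,
    ← Finset.card_union_add_card_inter]
  refine add_le_add (Finset.card_le_card
    (Finset.union_subset (G.incidenceFinset_subset x) (G.incidenceFinset_subset y))) ?_
  -- Only the edge `xy` is counted at both ends.
  rw [← Finset.card_singleton s(x, y)]
  refine Finset.card_le_card fun e he => ?_
  rw [Finset.mem_inter, mem_incidenceFinset, mem_incidenceFinset] at he
  exact Finset.mem_singleton.2 (G.incidenceSet_inter_incidenceSet_subset h.ne he)

open Finset in
/-- The Anderson–Morley bound, in the form `μ ≤ m + 1`. -/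
theorem lapMatrix_eigenvalue_le {μ : ℝ} {u : V → ℝ} (hu : u ≠ 0)
    (h : (G.lapMatrix ℝ).mulVec u = μ • u) : μ ≤ #G.edgeFinset + 1 := by
  by_cases h0 : (G.lapMatrix ℝ).mulVec u = 0
  · rw [h0] at h
    have : μ = 0 := (smul_eq_zero.1 h.symm).resolve_right hu
    rw [this]
    positivity
  rw [lapMatrix_mulVec_eq_zero_iff_forall_adj] at h0
  push Not at h0
  obtain ⟨p, q, hpq, hne⟩ := h0
  -- Across the edge with the largest jump of `u`, subtract the two rows of the eigenvalue equation;
  -- each term in them is at most that jump.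
  obtain ⟨⟨x, y⟩, hxy, hmax⟩ := exists_max_image (univ.filter fun e : V × V => G.Adj e.1 e.2)
    (fun e => |u e.1 - u e.2|) ⟨(p, q), by simpa using hpq⟩
  simp only [mem_filter, mem_univ, true_and, Prod.forall] at hxy hmax
  have hpos : 0 < |u x - u y| :=
    (abs_pos.2 (sub_ne_zero.2 hne)).trans_le (hmax p q hpq)
  have hrow : ∀ w, |μ * u w| ≤ G.degree w * |u x - u y| := by
    intro w
    have hw : μ * u w = ∑ z ∈ G.neighborFinset w, (u w - u z) := by
      have := congrFun h w
      rw [lapMatrix_mulVec_apply] at this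
      simpa [sum_sub_distrib] using this.symm
    rw [hw, ← card_neighborFinset_eq_degree, ← nsmul_eq_mul]
    exact (abs_sum_le_sum_abs _ _).trans
      (sum_le_card_nsmul _ _ _ fun z hz => hmax w z ((G.mem_neighborFinset w z).1 hz))
  have hdeg : (G.degree x + G.degree y : ℝ) ≤ #G.edgeFinset + 1 :=
    mod_cast G.degree_add_degree_le_card_edgeFinset_add_one hxy
  refine le_of_mul_le_mul_right ?_ hpos
  calc μ * |u x - u y| ≤ |μ| * |u x - u y| := by gcongr; exact le_abs_self μ
    _ = |μ * u x - μ * u y| := by rw [← abs_mul, mul_sub]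
    _ ≤ |μ * u x| + |μ * u y| := abs_sub _ _
    _ ≤ (G.degree x + G.degree y) * |u x - u y| := by linarith [hrow x, hrow y]
    _ ≤ (#G.edgeFinset + 1) * |u x - u y| := by gcongr

theorem lapMatrix_eigenvalues_le (k : V) :
    (G.isHermitian_lapMatrix ℝ).eigenvalues k ≤ G.edgeFinset.card + 1 := by
  refine G.lapMatrix_eigenvalue_le ?_ ((G.isHermitian_lapMatrix ℝ).mulVec_eigenvectorBasis k)
  intro h
  refine (G.isHermitian_lapMatrix ℝ).eigenvectorBasis.orthonormal.ne_zero k ?_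
  ext i
  exact congrFun h i

theorem sum_lapMatrix_eigenvalues :
    ∑ k, (G.isHermitian_lapMatrix ℝ).eigenvalues k = 2 * G.edgeFinset.card := by
  have h := (G.isHermitian_lapMatrix ℝ).trace_eq_sum_eigenvalues
  have ht : (G.lapMatrix ℝ).trace = 2 * G.edgeFinset.card := by
    rw [lapMatrix, Matrix.trace_sub, trace_adjMatrix, degMatrix, Matrix.trace_diagonal, sub_zero]
    exact_mod_cast G.sum_degrees_eq_twice_card_edges
  simpa [ht] using h.symm

/-! ### Graphs whose edges all share a vertex -/

/-- If the degree of `v` equals the number of edges, then every edge is incident to `v`. -/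
theorem eq_or_eq_of_adj_of_degree_eq {v : V} (hv : G.degree v = G.edgeFinset.card) {x y : V}
    (h : G.Adj x y) : v = x ∨ v = y := by
  rw [← card_incidenceFinset_eq_degree] at hv
  have he := Finset.eq_of_subset_of_card_le (G.incidenceFinset_subset v) hv.ge
  have hm : s(x, y) ∈ G.incidenceFinset v := by rw [he]; simpa using h
  rw [mem_incidenceFinset] at hm
  simpa using hm.2

theorem nonempty_iso_starUnionIsolated {v : V} (hv : G.degree v = G.edgeFinset.card) {r : ℕ}
    (hr : G.degree v + r + 1 = Fintype.card V) :
    Nonempty (G ≃g starUnionIsolated (G.degree v) r) := by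
  have hcN : Fintype.card (Fin (G.degree v)) = Fintype.card {x // x ∈ G.neighborFinset v} := by
    rw [Fintype.card_fin, Fintype.card_coe, card_neighborFinset_eq_degree]
  have hcR : Fintype.card (Fin r) = Fintype.card {x // x ∉ insert v (G.neighborFinset v)} := by
    rw [Fintype.card_subtype_compl, Fintype.card_coe,
      Finset.card_insert_of_notMem (G.notMem_neighborFinset_self v),
      card_neighborFinset_eq_degree, Fintype.card_fin]
    omega
  obtain ⟨eN⟩ := Fintype.card_eq.1 hcN
  obtain ⟨eR⟩ := Fintype.card_eq.1 hcR
  let g : (Fin 1 ⊕ Fin (G.degree v)) ⊕ Fin r → V :=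
    Sum.elim (Sum.elim (fun _ => v) fun i => eN i) fun i => eR i
  have hN : ∀ i, G.Adj v (eN i) := fun i => (G.mem_neighborFinset v _).1 (eN i).2
  have hR1 : ∀ i, (eR i : V) ≠ v := fun i h => (eR i).2 (by simp [h])
  have hR2 : ∀ i, ¬ G.Adj v (eR i) := fun i h => (eR i).2 (by simp [h])
  have hinj : Function.Injective g := by
    rintro ((a | a) | a) ((b | b) | b) hab <;> simp only [g, Sum.elim_inl, Sum.elim_inr] at hab
    · rw [Subsingleton.elim a b]
    · exact absurd hab (hN b).ne
    · exact absurd hab.symm (hR1 b)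
    · exact absurd hab.symm (hN a).ne
    · rw [eN.injective (Subtype.ext hab)]
    · exact absurd (hab ▸ hN a) (hR2 b)
    · exact absurd hab (hR1 a)
    · exact absurd (hab ▸ hN b) (hR2 a)
    · rw [eR.injective (Subtype.ext hab)]
  have hbij : Function.Bijective g :=
    (Fintype.bijective_iff_injective_and_card g).2 ⟨hinj, by simp; omega⟩
  have hoff : ∀ {x y : V}, x ≠ v → y ≠ v → ¬ G.Adj x y := fun hx hy h =>
    (G.eq_or_eq_of_adj_of_degree_eq hv h).elim (fun e => hx e.symm) fun e => hy e.symm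
  have hiso : ∀ {a b}, G.Adj (Equiv.ofBijective g hbij a) (Equiv.ofBijective g hbij b)
      ↔ (starUnionIsolated (G.degree v) r).Adj a b := by
    rintro ((a | a) | a) ((b | b) | b) <;>
      simp only [Equiv.ofBijective_apply, g, Sum.elim_inl, Sum.elim_inr, starUnionIsolated]
    · simp
    · simpa using hN b
    · simpa using hR2 b
    · simpa using (hN a).symm
    · simpa using hoff (hN a).ne' (hN b).ne'
    · simpa using hoff (hN a).ne' (hR1 b)
    · simpa using fun h : G.Adj _ _ => hR2 a h.symm
    · simpa using hoff (hR1 a) (hN b).ne'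
    · simpa using hoff (hR1 a) (hR1 b)
  exact ⟨(RelIso.mk (Equiv.ofBijective g hbij) hiso : starUnionIsolated _ r ≃g G).symm⟩

/-- A graph all of whose edges, more than `n / 2` in number, share a vertex is an exceptional
star. -/
theorem isExceptionalStar_of_degree_eq {v : V} (hv : G.degree v = G.edgeFinset.card)
    (h : Fintype.card V < 2 * G.degree v) : IsExceptionalStar G := by
  have hlt := G.degree_lt_card_verts v
  refine ⟨G.degree v, Fintype.card V - G.degree v - 1, by omega, Or.inl ?_,
    G.nonempty_iso_starUnionIsolated hv (by omega)⟩
  -- With r = n - d - 1, the bound r ≤ ⌈n/2⌉ - 2 says n - d < n/2.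
  have : ((Fintype.card V - G.degree v : ℕ) : ℤ) ≤ ⌈(Fintype.card V : ℚ) / 2⌉ - 1 := by
    rw [Int.le_sub_one_iff, Int.lt_ceil, lt_div_iff₀ two_pos, Int.cast_natCast]
    exact_mod_cast (by omega : (Fintype.card V - G.degree v) * 2 < Fintype.card V)
  omega

/-! ### The energy bound -/

open Finset in
theorem laplacianEnergy_eq [Nonempty V] :
    laplacianEnergy G = 2 * ∑ k with 2 * (#G.edgeFinset : ℝ) / Fintype.card V
        ≤ (G.isHermitian_lapMatrix ℝ).eigenvalues k,
      ((G.isHermitian_lapMatrix ℝ).eigenvalues k - 2 * (#G.edgeFinset : ℝ) / Fintype.card V) := by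
  set c : ℝ := 2 * (#G.edgeFinset : ℝ) / Fintype.card V with hc
  have hreindex : laplacianEnergy G = ∑ k, |(G.isHermitian_lapMatrix ℝ).eigenvalues k - c| :=
    (Equiv.sum_comp (Fintype.equivOfCardEq (Fintype.card_fin _)).symm
      fun i => |laplacianEigenvalue G i - c|).symm
  have hzero : ∑ k, ((G.isHermitian_lapMatrix ℝ).eigenvalues k - c) = 0 := by
    rw [sum_sub_distrib, sum_lapMatrix_eigenvalues, sum_const, card_univ, nsmul_eq_mul, hc]
    field_simp
    ring
  have habs : ∀ k, |(G.isHermitian_lapMatrix ℝ).eigenvalues k - c|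
      = 2 * (if c ≤ (G.isHermitian_lapMatrix ℝ).eigenvalues k
          then (G.isHermitian_lapMatrix ℝ).eigenvalues k - c else 0)
        - ((G.isHermitian_lapMatrix ℝ).eigenvalues k - c) := by
    intro k
    split_ifs with h
    · rw [abs_of_nonneg (by linarith)]; ring
    · rw [abs_of_neg (by linarith)]; ring
  rw [hreindex, sum_congr rfl fun k _ => habs k, sum_sub_distrib, hzero, sub_zero, ← mul_sum,
    ← sum_filter]

end SimpleGraph

theorem theorem4p4 {V : Type*} [Fintype V] [DecidableEq V] [Nonempty V]
    (G : SimpleGraph V) [DecidableRel G.Adj] (n m Δ₁ : ℕ)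
    (hn : n = Fintype.card V) (hm : m = G.edgeFinset.card) (hΔ : Δ₁ = G.maxDegree)
    (hmn : (n : ℝ) / 2 ≤ (m : ℝ)) (hG : ¬ IsExceptionalStar G) :
    laplacianEnergy G ≤ 4 * (m : ℝ) - 2 * (Δ₁ : ℝ) - 8 * (m : ℝ) / (n : ℝ) + 4 ∧
      4 * (m : ℝ) - 2 * (Δ₁ : ℝ) - 8 * (m : ℝ) / (n : ℝ) + 4 ≤
        4 * (m : ℝ) - 2 * (Δ₁ : ℝ) - 4 * (m : ℝ) / (n : ℝ) + 2 := by
  have hnpos : 0 < n := hn ▸ Fintype.card_pos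
  have hnR : (0 : ℝ) < n := mod_cast hnpos
  obtain ⟨c, hc⟩ : ∃ c : ℝ, c = 2 * (m : ℝ) / n := ⟨_, rfl⟩
  have hc1 : 1 ≤ c := by rw [hc, le_div_iff₀ hnR]; linarith
  have h8 : 8 * (m : ℝ) / n = 4 * c := by rw [hc]; ring
  have h4 : 4 * (m : ℝ) / n = 2 * c := by rw [hc]; ring
  rw [h8, h4]
  refine ⟨?_, by linarith⟩
  obtain ⟨v, hv⟩ := G.exists_maximal_degree_vertex
  have hvΔ : G.degree v = Δ₁ := by rw [hΔ, hv]
  have hΔm : Δ₁ ≤ m := by rw [← hvΔ, hm]; exact G.degree_le_card_edgeFinset v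
  have hΔn : Δ₁ + 1 ≤ n := by rw [← hvΔ, hn]; exact G.degree_lt_card_verts v
  rw [G.laplacianEnergy_eq, ← hm, ← hn, ← hc]
  have hsum := G.sum_lapMatrix_eigenvalues
  rw [← hm] at hsum
  set μ := (G.isHermitian_lapMatrix ℝ).eigenvalues with hμ
  set S := Finset.univ.filter fun k => c ≤ μ k with hS
  -- Not all eigenvalues lie below their mean.
  obtain ⟨w, hw⟩ : S.Nonempty := by
    by_contra h
    rw [Finset.not_nonempty_iff_eq_empty, Finset.filter_eq_empty_iff] at h
    have hlt : ∑ k, μ k < ∑ _k : V, c :=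
      Finset.sum_lt_sum_of_nonempty Finset.univ_nonempty fun k hk => not_le.1 (h hk)
    rw [hsum, Finset.sum_const, Finset.card_univ, nsmul_eq_mul, ← hn, hc,
      mul_div_cancel₀ _ hnR.ne'] at hlt
    exact lt_irrefl _ hlt
  rcases Nat.lt_or_ge 1 S.card with hS2 | hS1
  · have hle := G.sum_lapMatrix_form_le
      (G.isHermitian_lapMatrix ℝ).eigenvectorBasis.orthonormal S v
    rw [← Finset.sum_congr rfl fun k _ => G.lapMatrix_eigenvalues_eq k, hvΔ, ← hm, ← hμ] at hle
    rw [Finset.sum_sub_distrib, Finset.sum_const, nsmul_eq_mul]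
    have hS2' : (2 : ℝ) ≤ S.card := mod_cast hS2
    nlinarith
  · obtain ⟨k, hk⟩ := Finset.card_eq_one.1 (le_antisymm hS1 (Finset.card_pos.2 ⟨w, hw⟩))
    rw [hk, Finset.sum_singleton]
    have hμk := G.lapMatrix_eigenvalues_le k
    rw [← hm, ← hμ] at hμk
    suffices hcm : c ≤ m - Δ₁ + 1 by linarith
    rw [hc, div_le_iff₀ hnR]
    rcases hΔm.eq_or_lt with heq | hlt
    · have h2 : 2 * Δ₁ ≤ n := by
        by_contra h
        exact hG (G.isExceptionalStar_of_degree_eq (v := v) (by omega) (by omega))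
      rw [heq] at h2 ⊢
      have : (2 * m : ℝ) ≤ n := mod_cast h2
      linarith
    · have h1 : (Δ₁ : ℝ) + 1 ≤ m := mod_cast hlt
      have h2 : (Δ₁ : ℝ) + 1 ≤ n := mod_cast hΔn
      have h3 : (2 : ℝ) ≤ n := by
        rcases Nat.lt_or_ge n 2 with h | h
        · have := G.card_edgeFinset_le_card_choose_two
          rw [← hm, ← hn, (by omega : n = 1)] at this
          simp at this
          omega
        · exact_mod_cast h
      -- From (m - Δ₁ - 1)(n - 2) ≥ 0 and Δ₁ + 1 ≤ n: n(m - Δ₁ + 1) ≥ 2(m - Δ₁ - 1) + 2n ≥ 2m.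
      nlinarith [mul_nonneg (sub_nonneg.2 h1) (sub_nonneg.2 h3)]
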